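/- Let $F=\langle x_k,\ k\ge 0 \mid x_i^{-1}x_jx_i=x_{j+1} \text{ for } i<j\rangle$ be Thompson's group, with the word metric of its finite generating set $\{x_0,x_1\}$. For every integer $n\ge 0$, let $H_n\le F$ be the subgroup generated by $$x_0x_1^{-1},\ x_2x_3^{-1},\ \ldots,\ x_{2n-2}x_{2n-1}^{-1},\ x_{2n},\ x_{2n+1},$$ and let $A_n\le H_n$ be the subgroup generated by $x_0x_1^{-1},\ldots,x_{2n-2}x_{2n-1}^{-1}$. Then there is an isomorphism $F\times\mathbb{Z}^n\to H_n$ that maps $(x_0,0)$ to $x_{2n}$, $(x_1,0)$ to $x_{2n+1}$ and, for $0\le i<n$, $(1,e_i)$ to $x_{2i}x_{2i+1}^{-1}$, where $e_0,\ldots,e_{n-1}$ is the standard basis of $\mathbb{Z}^n$; it maps the factor $\mathbb{Z}^n$ onto $A_n$. Both $H_n$ and the free abelian group $A_n\cong\mathbb{Z}^n$ are quasi-isometrically embedded in $F$: for each of these two subgroups, with the word metric $d$ of any of its finite generating sets, there are constants $K,C>0$ such that $$\frac{d(a,b)}{K}-C\le d_F(a,b)\le K\,d(a,b)+C$$ for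 all elements $a,b$ of the subgroup, where $d_F$ is the word metric of $F$. -/

import Mathlib

/-! ### Thompson's group -/

/-- The relators `xᵢ⁻¹ xⱼ xᵢ xⱼ₊₁⁻¹`, for `i < j`. -/
def thompsonRels : Set (FreeGroup ℕ) :=
  {r | ∃ i j : ℕ, i < j ∧
    r = (FreeGroup.of i)⁻¹ * FreeGroup.of j * FreeGroup.of i * (FreeGroup.of (j + 1))⁻¹}

/-- Thompson's group `F = ⟨x₀, x₁, … | xᵢ⁻¹ xⱼ xᵢ = xⱼ₊₁ for i < j⟩`. -/
abbrev ThompsonF : Type := PresentedGroup thompsonRels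

namespace ThompsonF

/-- The generator `x_k` of `F`. -/
def x (k : ℕ) : ThompsonF := PresentedGroup.of k

theorem conj_x {i j : ℕ} (h : i < j) : (x i)⁻¹ * x j * x i = x (j + 1) := by
  have h1 : PresentedGroup.mk thompsonRels ((FreeGroup.of i)⁻¹ * FreeGroup.of j * FreeGroup.of i *
      (FreeGroup.of (j + 1))⁻¹) = 1 :=
    PresentedGroup.one_of_mem ⟨i, j, h, rfl⟩
  simp only [map_mul, map_inv] at h1
  exact mul_inv_eq_one.mp h1

/-- The finite generating set `{x₀, x₁}` of `F`, which is used for its word metric. -/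
def gens : Set ThompsonF := {x 0, x 1}

theorem closure_gens : Subgroup.closure gens = ⊤ := by
  have h0 : x 0 ∈ Subgroup.closure gens := Subgroup.subset_closure (by simp [gens])
  have h1 : x 1 ∈ Subgroup.closure gens := Subgroup.subset_closure (by simp [gens])
  have h : ∀ k, x (k + 1) ∈ Subgroup.closure gens := by
    intro k
    induction k with
    | zero => exact h1
    | succ k ih =>
      rw [← conj_x (Nat.succ_pos k)]
      exact mul_mem (mul_mem (inv_mem h0) ih) h0
  rw [eq_top_iff, ← PresentedGroup.closure_range_of thompsonRels, Subgroup.closure_le]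
  rintro _ ⟨k, rfl⟩
  cases k with
  | zero => exact h0
  | succ k => exact h k

/-- The element `y_i = x_{2i} x_{2i+1}⁻¹` of `F`. -/
def y (i : ℕ) : ThompsonF := x (2 * i) * (x (2 * i + 1))⁻¹

/-- The subgroup of `F` generated by `y_0, …, y_{n-1}, x_{2n}, x_{2n+1}`. -/
def subgroupH (n : ℕ) : Subgroup ThompsonF :=
  Subgroup.closure (y '' {i | i < n} ∪ {x (2 * n), x (2 * n + 1)})

/-- The subgroup of `F` generated by `y_0, …, y_{n-1}`. -/
def subgroupA (n : ℕ) : Subgroup ThompsonF :=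
  Subgroup.closure (y '' {i | i < n})

end ThompsonF

/-! ### Word metrics and quasi-isometric embeddings -/

/-- The word length of `g` with respect to a generating set `S` of the group: the least length of
a word in the elements of `S` and their inverses that represents `g`. -/
noncomputable def wordLength {G : Type*} [Group G] (S : Set G) (g : G) : ℕ :=
  sInf {m | ∃ l : List G, (∀ s ∈ l, s ∈ S ∨ s⁻¹ ∈ S) ∧ l.prod = g ∧ l.length = m}

/-- The (left-invariant) word metric with respect to a generating set `S`. -/
noncomputable def wordDist {G : Type*} [Group G] (S : Set G) (g h : G) : ℝ :=
  (wordLength S (g⁻¹ * h) : ℝ)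

/-- `f` is a quasi-isometric embedding with respect to the distance functions `dX` and `dY`. -/
def IsQuasiIsometricEmbedding {X Y : Type*} (dX : X → X → ℝ) (dY : Y → Y → ℝ) (f : X → Y) : Prop :=
  ∃ K C : ℝ, 0 < K ∧ 0 < C ∧ ∀ a b : X,
    dX a b / K - C ≤ dY (f a) (f b) ∧ dY (f a) (f b) ≤ K * dX a b + C

/-- `S` is a finite generating set of the group `G`, which carries the word metric of `S`, and the
subgroup `H` is quasi-isometrically embedded in `G`: it is finitely generated and its inclusion into `G` is a
quasi-isometric embedding for the word metric of every finite generating set of `H`. -/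
def IsQIEmbeddedSubgroup {G : Type*} [Group G] (S : Set G) (H : Subgroup G) : Prop :=
  S.Finite ∧ Subgroup.closure S = ⊤ ∧ H.FG ∧ ∀ T : Set H, T.Finite → Subgroup.closure T = ⊤ →
    IsQuasiIsometricEmbedding (wordDist T) (wordDist S) (fun h : H => (h : G))

/-! ### Word length -/

section WordLength

variable {G H : Type*} [Group G] [Group H]

/-! Let σ be the endomorphism `shift`. Since `y 0` commutes with σ²(F) (`commute_y_zero`), an
induction on `n` gives a homomorphism sending `(g, v)` to `y 0 ^ v 0 ⋯ y (n-1) ^ v (n-1) * σ²ⁿ(g)`,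
whose image is `subgroupH n`. Homomorphisms of finitely generated groups are Lipschitz, so what
remains is injectivity and a linear bound of `|g| + ∑ |v i|` by the length of the image.

Both come from fraction forms `p q⁻¹` (`IsFrac m k`), with `m` bounding the generators used and `k`
the total exponent. An element of length `N` has such a form with `m = 2N`, `k = N`
(`isFrac_wordLength`), and any form gives length at most `k + 2m` (`IsFrac.wordLength_le`), so forms
measure length up to a constant factor. Forms need not be unique or reduced. The key step
(`IsFrac.of_x_zero_pow_mul_shift`, `IsFrac.of_y_zero_zpow_mul`) peels `y 0 ^ v` off a form of `y 0 ^
v * σ²(g)`: what is left is a form of `g`, and the budget `k` drops by at least `|v|`. Peeling needs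
σ to be injective, which follows from a faithful action of `F` on the line where σ becomes
conjugation by a translation. -/

theorem wordLength_prod_le {S : Set G} {l : List G} (hl : ∀ s ∈ l, s ∈ S ∨ s⁻¹ ∈ S) :
    wordLength S l.prod ≤ l.length :=
  Nat.sInf_le ⟨l, hl, rfl, rfl⟩

theorem exists_list_length_eq_wordLength {S : Set G} (hS : Subgroup.closure S = ⊤) (g : G) :
    ∃ l : List G, (∀ s ∈ l, s ∈ S ∨ s⁻¹ ∈ S) ∧ l.prod = g ∧ l.length = wordLength S g := by
  have hg : g ∈ Subgroup.closure S := hS ▸ Subgroup.mem_top g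
  rw [← Subgroup.mem_toSubmonoid, Subgroup.closure_toSubmonoid] at hg
  obtain ⟨l, hl, hp⟩ := Submonoid.exists_list_of_mem_closure hg
  exact Nat.sInf_mem (s := {m | ∃ l : List G, (∀ s ∈ l, s ∈ S ∨ s⁻¹ ∈ S) ∧ l.prod = g ∧
    l.length = m}) ⟨l.length, l, hl, hp, rfl⟩

theorem wordLength_one (S : Set G) : wordLength S (1 : G) = 0 := by
  simpa using wordLength_prod_le (S := S) (l := []) (by simp)

theorem wordLength_le_one_of_mem {S : Set G} {g : G} (hg : g ∈ S) : wordLength S g ≤ 1 := by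
  simpa using wordLength_prod_le (S := S) (l := [g]) (by simp [hg])

theorem wordLength_mul_le {S : Set G} (hS : Subgroup.closure S = ⊤) (g h : G) :
    wordLength S (g * h) ≤ wordLength S g + wordLength S h := by
  obtain ⟨l, hl, rfl, hlen⟩ := exists_list_length_eq_wordLength hS g
  obtain ⟨l', hl', rfl, hlen'⟩ := exists_list_length_eq_wordLength hS h
  rw [← hlen, ← hlen', ← List.prod_append, ← List.length_append]
  refine wordLength_prod_le fun s hs => ?_
  rcases List.mem_append.mp hs with hs | hs
  exacts [hl s hs, hl' s hs]

theorem wordLength_inv_le {S : Set G} (hS : Subgroup.closure S = ⊤) (g : G) :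
    wordLength S g⁻¹ ≤ wordLength S g := by
  obtain ⟨l, hl, rfl, hlen⟩ := exists_list_length_eq_wordLength hS g
  rw [← hlen, List.prod_inv_reverse]
  refine (wordLength_prod_le fun s hs => ?_).trans_eq (by simp)
  simp only [List.mem_reverse, List.mem_map] at hs
  obtain ⟨t, ht, rfl⟩ := hs
  simpa [or_comm] using hl t ht

theorem wordLength_list_prod_le {S : Set G} (hS : Subgroup.closure S = ⊤) (l : List G) :
    wordLength S l.prod ≤ (l.map (wordLength S)).sum := by
  induction l with
  | nil => simp [wordLength_one]
  | cons g l ih =>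
    simpa using (wordLength_mul_le hS g l.prod).trans (Nat.add_le_add_left ih _)

theorem wordLength_pow_le {S : Set G} (hS : Subgroup.closure S = ⊤) (g : G) (k : ℕ) :
    wordLength S (g ^ k) ≤ k * wordLength S g := by
  simpa using wordLength_list_prod_le hS (List.replicate k g)

theorem wordLength_zpow_le {S : Set G} (hS : Subgroup.closure S = ⊤) (g : G) (k : ℤ) :
    wordLength S (g ^ k) ≤ k.natAbs * wordLength S g := by
  obtain ⟨m, rfl | rfl⟩ := k.eq_nat_or_neg
  · simpa using wordLength_pow_le hS g m
  · simpa using (wordLength_inv_le hS _).trans (wordLength_pow_le hS g m)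

/-- A homomorphism of finitely generated groups is Lipschitz for the word lengths. -/
theorem exists_wordLength_map_le (f : G →* H) {S : Set G} {T : Set H} (hfin : S.Finite)
    (hS : Subgroup.closure S = ⊤) (hT : Subgroup.closure T = ⊤) :
    ∃ c : ℕ, ∀ g, wordLength T (f g) ≤ c * wordLength S g := by
  obtain ⟨c, hc⟩ := (hfin.image fun s => wordLength T (f s)).bddAbove
  have hc' : ∀ s, s ∈ S ∨ s⁻¹ ∈ S → wordLength T (f s) ≤ c := by
    rintro s (hs | hs)
    · exact hc ⟨s, hs, rfl⟩
    · have h1 := wordLength_inv_le hT (f s⁻¹)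
      rw [map_inv, inv_inv, ← map_inv] at h1
      exact h1.trans (hc ⟨s⁻¹, hs, rfl⟩)
  refine ⟨c, fun g => ?_⟩
  obtain ⟨l, hl, rfl, hlen⟩ := exists_list_length_eq_wordLength hS g
  rw [← hlen, map_list_prod]
  refine (wordLength_list_prod_le hT _).trans ?_
  rw [mul_comm, ← smul_eq_mul]
  refine (List.sum_le_card_nsmul _ c ?_).trans_eq (by simp)
  intro k hk
  simp only [List.map_map, List.mem_map, Function.comp_apply] at hk
  obtain ⟨s, hs, rfl⟩ := hk
  exact hc' s (hl s hs)

/-- A finitely generated subgroup whose intrinsic word lengths are linearly bounded by the ambient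
word length is quasi-isometrically embedded. -/
theorem isQIEmbeddedSubgroup_of_wordLength_le {S : Set G} {K : Subgroup G} (hfin : S.Finite)
    (hS : Subgroup.closure S = ⊤) (hK : K.FG)
    (h : ∀ T : Set K, Subgroup.closure T = ⊤ →
      ∃ c : ℕ, ∀ g : K, wordLength T g ≤ c * wordLength S (g : G)) :
    IsQIEmbeddedSubgroup S K := by
  refine ⟨hfin, hS, hK, fun T hTfin hT => ?_⟩
  obtain ⟨c, hc⟩ := h T hT
  obtain ⟨d, hd⟩ := exists_wordLength_map_le K.subtype hTfin hT hS
  -- The summand 1 only makes the multiplicative constant positive. No additive error is needed, but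
  -- `0 < C` is required.
  refine ⟨c + d + 1, 1, by positivity, one_pos, fun a b => ?_⟩
  have h1 : (wordLength T (a⁻¹ * b) : ℝ) ≤ c * wordLength S ((a : G)⁻¹ * b) := by
    exact_mod_cast hc (a⁻¹ * b)
  have h2 : (wordLength S ((a : G)⁻¹ * b) : ℝ) ≤ d * wordLength T (a⁻¹ * b) := by
    exact_mod_cast hd (a⁻¹ * b)
  have hA : (0 : ℝ) ≤ wordLength T (a⁻¹ * b) := Nat.cast_nonneg _
  have hB : (0 : ℝ) ≤ wordLength S ((a : G)⁻¹ * b) := Nat.cast_nonneg _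
  have hc0 : (0 : ℝ) ≤ c := Nat.cast_nonneg _
  have hd0 : (0 : ℝ) ≤ d := Nat.cast_nonneg _
  unfold wordDist
  constructor
  · have : (wordLength T (a⁻¹ * b) : ℝ) / (c + d + 1) ≤ wordLength S ((a : G)⁻¹ * b) := by
      rw [div_le_iff₀ (by positivity)]
      nlinarith [mul_nonneg hd0 hB]
    linarith
  · nlinarith [mul_nonneg hc0 hA]

end WordLength

/-! ### The shift endomorphism and the exponent sum -/

namespace ThompsonF

/-- Homomorphisms on `F` are determined by the images of the `x k`. -/
theorem hom_ext {G : Type*} [Group G] {f g : ThompsonF →* G} (h : ∀ k, f (x k) = g (x k)) :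
    f = g :=
  PresentedGroup.ext h

/-- A sequence in a group that satisfies the relations of `F` extends to `F`. -/
def lift {G : Type*} [Group G] (f : ℕ → G) (hf : ∀ i j, i < j → f j * f i = f i * f (j + 1)) :
    ThompsonF →* G :=
  PresentedGroup.toGroup (f := f) (by
    rintro r ⟨i, j, hij, rfl⟩
    simp only [map_mul, map_inv, FreeGroup.lift_apply_of]
    rw [mul_inv_eq_one, mul_assoc, inv_mul_eq_iff_eq_mul, hf i j hij])

@[simp]
theorem lift_x {G : Type*} [Group G] (f : ℕ → G)
    (hf : ∀ i j, i < j → f j * f i = f i * f (j + 1)) (k : ℕ) : lift f hf (x k) = f k :=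
  PresentedGroup.toGroup.of _

theorem x_mul_x {i j : ℕ} (h : i < j) : x j * x i = x i * x (j + 1) := by
  rw [← conj_x h]; group

/-- The endomorphism `x k ↦ x (k + 1)` of `F`. -/
def shift : ThompsonF →* ThompsonF :=
  lift (fun k => x (k + 1)) fun _ _ h => x_mul_x (Nat.succ_lt_succ h)

@[simp]
theorem shift_x (k : ℕ) : shift (x k) = x (k + 1) := lift_x _ _ k

/-- The relations with `i = 0` say that conjugation by `x 0` acts on the image of `shift` as one
more shift. -/
theorem shift_mul_x_zero (g : ThompsonF) : shift g * x 0 = x 0 * shift (shift g) := by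
  have h : shift = ((MulAut.conj (x 0)).toMonoidHom.comp shift).comp shift := by
    refine hom_ext fun k => ?_
    simp only [MonoidHom.comp_apply, shift_x, MulEquiv.coe_toMonoidHom, MulAut.conj_apply]
    rw [← x_mul_x (Nat.succ_pos k)]; group
  have h1 := DFunLike.congr_fun h g
  simp only [MonoidHom.comp_apply, MulEquiv.coe_toMonoidHom, MulAut.conj_apply] at h1
  nth_rewrite 1 [h1]; group

theorem shift_mul_x_zero_pow (g : ThompsonF) (b : ℕ) :
    shift g * x 0 ^ b = x 0 ^ b * shift (shift^[b] g) := by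
  induction b generalizing g with
  | zero => simp
  | succ b ih =>
    rw [pow_succ', ← mul_assoc, shift_mul_x_zero, mul_assoc, ih, ← mul_assoc,
      Function.iterate_succ_apply]

theorem shift_iterate_x (m k : ℕ) : shift^[m] (x k) = x (k + m) := by
  induction m with
  | zero => rfl
  | succ m ih => rw [Function.iterate_succ_apply', ih, shift_x, add_assoc]

/-- The exponent sum of `x 0`. -/
def exponent : ThompsonF →* Multiplicative ℤ :=
  lift (fun k => if k = 0 then Multiplicative.ofAdd 1 else 1) fun i j h => by
    simp [show j ≠ 0 by omega]

@[simp]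
theorem exponent_x_zero : exponent (x 0) = Multiplicative.ofAdd 1 := lift_x _ _ 0

@[simp]
theorem exponent_shift (g : ThompsonF) : exponent (shift g) = 1 := by
  have h : exponent.comp shift = 1 := hom_ext fun k => by
    simp only [MonoidHom.comp_apply, shift_x]
    exact (lift_x _ _ (k + 1)).trans (by simp)
  exact DFunLike.congr_fun h g

/-! ### Fraction forms -/

/-- `g` is a fraction `p q⁻¹` of products `x₀ ^ a₀ ⋯ x_{m-1} ^ a_{m-1}` and
`x₀ ^ b₀ ⋯ x_{m-1} ^ b_{m-1}` whose exponents add up to at most `k`. -/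
def IsFrac : ℕ → ℕ → ThompsonF → Prop
  | 0, _, g => g = 1
  | m + 1, k, g => ∃ a b k' h, a + b + k' ≤ k ∧ IsFrac m k' h ∧
      g = x 0 ^ a * shift h * (x 0 ^ b)⁻¹

theorem isFrac_one (m k : ℕ) : IsFrac m k 1 := by
  induction m with
  | zero => rfl
  | succ m ih => exact ⟨0, 0, k, 1, by simp, ih, by simp⟩

theorem IsFrac.mono {m m' k k' : ℕ} {g : ThompsonF} (h : IsFrac m k g) (hm : m ≤ m')
    (hk : k ≤ k') : IsFrac m' k' g := by
  induction m generalizing m' k k' g with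
  | zero => obtain rfl : g = 1 := h; exact isFrac_one _ _
  | succ m ih =>
    obtain ⟨a, b, l, h, hl, hf, rfl⟩ := h
    obtain ⟨m', rfl⟩ : ∃ r, m' = r + 1 := ⟨m' - 1, by omega⟩
    exact ⟨a, b, l, h, hl.trans hk, ih hf (by omega) le_rfl, rfl⟩

theorem IsFrac.inv {m k : ℕ} {g : ThompsonF} (h : IsFrac m k g) : IsFrac m k g⁻¹ := by
  induction m generalizing k g with
  | zero => obtain rfl : g = 1 := h; exact inv_one
  | succ m ih =>
    obtain ⟨a, b, l, h, hl, hf, rfl⟩ := h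
    exact ⟨b, a, l, h⁻¹, by omega, ih hf, by simp [mul_assoc]⟩

theorem IsFrac.shift {m k : ℕ} {g : ThompsonF} (h : IsFrac m k g) :
    IsFrac (m + 1) k (shift g) :=
  ⟨0, 0, k, g, by simp, h, by simp⟩

theorem isFrac_x (j : ℕ) : IsFrac (j + 1) 1 (x j) := by
  induction j with
  | zero => exact ⟨1, 0, 0, 1, by simp, rfl, by simp⟩
  | succ j ih => simpa using ih.shift

theorem x_succ_mul_x_zero_pow (j a : ℕ) : x (j + 1) * x 0 ^ a = x 0 ^ a * x (j + a + 1) := by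
  simpa [shift_iterate_x] using shift_mul_x_zero_pow (x j) a

theorem inv_x_succ_mul_x_zero_pow (j a : ℕ) :
    (x (j + 1))⁻¹ * x 0 ^ a = x 0 ^ a * (x (j + a + 1))⁻¹ := by
  rw [inv_mul_eq_iff_eq_mul, ← mul_assoc, x_succ_mul_x_zero_pow, mul_inv_cancel_right]

/-- Passing a power `x 0 ^ a` raises the index of the new letter by `a`, and the recursion goes on
one level deeper. All raises together are at most `k`, which explains `j + k` in the level bound. -/
theorem IsFrac.x_mul {m k : ℕ} {g : ThompsonF} (h : IsFrac m k g) (j : ℕ) :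
    IsFrac (max m (j + k) + 1) (k + 1) (x j * g) := by
  induction m generalizing k g j with
  | zero =>
    obtain rfl : g = 1 := h
    rw [mul_one]
    exact (isFrac_x j).mono (by omega) (by omega)
  | succ m ih =>
    obtain ⟨a, b, l, h, hl, hf, rfl⟩ := h
    cases j with
    | zero =>
      refine IsFrac.mono (m := m + 1) (k := k + 1) ?_ (by omega) le_rfl
      exact ⟨a + 1, b, l, h, by omega, hf, by simp [pow_succ', mul_assoc]⟩
    | succ j =>
      refine IsFrac.mono (m := max m (j + a + l) + 1 + 1) (k := k + 1) ?_ (by omega) le_rfl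
      refine ⟨a, b, l + 1, x (j + a) * h, by omega, ih hf _, ?_⟩
      rw [← mul_assoc, ← mul_assoc, x_succ_mul_x_zero_pow, map_mul, shift_x, mul_assoc (x 0 ^ a)]

theorem IsFrac.inv_x_mul {m k : ℕ} {g : ThompsonF} (h : IsFrac m k g) (j : ℕ) :
    IsFrac (max m (j + k) + 1) (k + 1) ((x j)⁻¹ * g) := by
  induction m generalizing k g j with
  | zero =>
    obtain rfl : g = 1 := h
    rw [mul_one]
    exact (isFrac_x j).inv.mono (by omega) (by omega)
  | succ m ih =>
    obtain ⟨a, b, l, h, hl, hf, rfl⟩ := h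
    cases j with
    | zero =>
      cases a with
      | zero =>
        -- With no leading `x 0` to cancel, `(x 0)⁻¹` moves right past `shift h` into the
        -- denominator and shifts `h` once more, at the cost of one level.
        refine IsFrac.mono (m := m + 1 + 1) (k := k + 1) ?_ (by omega) le_rfl
        refine ⟨0, b + 1, l, ThompsonF.shift h, by omega, hf.shift, ?_⟩
        have h1 := shift_mul_x_zero h
        rw [← inv_mul_eq_iff_eq_mul] at h1
        rw [← h1, pow_succ]; group
      | succ a =>
        refine IsFrac.mono (m := m + 1) (k := k + 1) ?_ (by omega) le_rfl
        exact ⟨a, b, l, h, by omega, hf, by simp [pow_succ', mul_assoc]⟩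
    | succ j =>
      refine IsFrac.mono (m := max m (j + a + l) + 1 + 1) (k := k + 1) ?_ (by omega) le_rfl
      refine ⟨a, b, l + 1, (x (j + a))⁻¹ * h, by omega, ih hf _, ?_⟩
      rw [← mul_assoc, ← mul_assoc, inv_x_succ_mul_x_zero_pow, map_mul, map_inv, shift_x,
        mul_assoc (x 0 ^ a)]

theorem isFrac_list_prod (l : List ThompsonF) (hl : ∀ s ∈ l, s ∈ gens ∨ s⁻¹ ∈ gens) :
    IsFrac (2 * l.length) l.length l.prod := by
  induction l with
  | nil => rfl
  | cons s l ih =>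
    have ih := ih fun t ht => hl t (List.mem_cons_of_mem _ ht)
    have hs : ∃ j ≤ 1, s = x j ∨ s = (x j)⁻¹ := by
      rcases hl s List.mem_cons_self with (h | h) | (h | h)
      · exact ⟨0, by omega, Or.inl h⟩
      · exact ⟨1, by omega, Or.inl h⟩
      · exact ⟨0, by omega, Or.inr (inv_eq_iff_eq_inv.mp h)⟩
      · exact ⟨1, by omega, Or.inr (inv_eq_iff_eq_inv.mp h)⟩
    rw [List.prod_cons, List.length_cons]
    obtain ⟨j, hj, rfl | rfl⟩ := hs
    · exact (ih.x_mul j).mono (by omega) le_rfl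
    · exact (ih.inv_x_mul j).mono (by omega) le_rfl

theorem isFrac_wordLength (g : ThompsonF) :
    IsFrac (2 * wordLength gens g) (wordLength gens g) g := by
  obtain ⟨l, hl, rfl, hlen⟩ := exists_list_length_eq_wordLength closure_gens g
  rw [← hlen]
  exact isFrac_list_prod l hl

theorem wordLength_x_le {j : ℕ} (hj : j < 2) (a : ℕ) : wordLength gens (x j ^ a) ≤ a := by
  have h : x j ∈ gens := by interval_cases j <;> simp [gens]
  refine (wordLength_pow_le closure_gens _ a).trans ?_
  simpa using Nat.mul_le_mul_left a (wordLength_le_one_of_mem h)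

/-- Each further shift of a shifted element is conjugation by `x 0`, so every level costs two
letters besides its powers of `x 1`. -/
theorem IsFrac.wordLength_shift_le {m k : ℕ} {g : ThompsonF} (h : IsFrac m k g) :
    wordLength gens (ThompsonF.shift g) ≤ k + 2 * m := by
  induction m generalizing k g with
  | zero => obtain rfl : g = 1 := h; simp [wordLength_one]
  | succ m ih =>
    obtain ⟨a, b, l, h, hl, hf, rfl⟩ := h
    have h1 := shift_mul_x_zero h
    rw [← inv_mul_eq_iff_eq_mul] at h1
    rw [map_mul, map_mul, map_inv, map_pow, map_pow, shift_x, ← h1]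
    have e1 := wordLength_mul_le closure_gens
      (x 1 ^ a * ((x 0)⁻¹ * (ThompsonF.shift h * x 0))) (x 1 ^ b)⁻¹
    have e2 := wordLength_mul_le closure_gens (x 1 ^ a) ((x 0)⁻¹ * (ThompsonF.shift h * x 0))
    have e3 := wordLength_mul_le closure_gens (x 0)⁻¹ (ThompsonF.shift h * x 0)
    have e4 := wordLength_mul_le closure_gens (ThompsonF.shift h) (x 0)
    have e5 := wordLength_inv_le closure_gens (x 0)
    have e6 := wordLength_inv_le closure_gens (x 1 ^ b)
    have e7 := wordLength_x_le one_lt_two a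
    have e8 := wordLength_x_le one_lt_two b
    have e9 := wordLength_x_le two_pos 1
    rw [pow_one] at e9
    have e10 := ih hf
    simp only [zero_add]
    omega

theorem IsFrac.wordLength_le {m k : ℕ} {g : ThompsonF} (h : IsFrac m k g) :
    wordLength gens g ≤ k + 2 * m := by
  cases m with
  | zero => obtain rfl : g = 1 := h; simp [wordLength_one]
  | succ m =>
    obtain ⟨a, b, l, h, hl, hf, rfl⟩ := h
    have e1 := wordLength_mul_le closure_gens (x 0 ^ a * ThompsonF.shift h) (x 0 ^ b)⁻¹
    have e2 := wordLength_mul_le closure_gens (x 0 ^ a) (ThompsonF.shift h)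
    have e3 := wordLength_inv_le closure_gens (x 0 ^ b)
    have e4 := wordLength_x_le two_pos a
    have e5 := wordLength_x_le two_pos b
    have e6 := hf.wordLength_shift_le
    omega

/-! ### The action on the line -/

/-- The piecewise linear homeomorphism of `ℝ` by which `x 0` acts. -/
noncomputable def plMap : Equiv.Perm ℝ where
  toFun t := if t ≤ 0 then t else if t ≤ 2 then t / 2 else t - 1
  invFun t := if t ≤ 0 then t else if t ≤ 1 then 2 * t else t + 1
  left_inv t := by dsimp only; split_ifs <;> linarith
  right_inv t := by dsimp only; split_ifs <;> linarith

theorem plMap_apply (t : ℝ) :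
    plMap t = if t ≤ 0 then t else if t ≤ 2 then t / 2 else t - 1 := rfl

/-- The action of `F` on `ℝ` by piecewise linear homeomorphisms; `x k` acts as the conjugate of
`plMap` by the translation by `k`. -/
noncomputable def act : ThompsonF →* Equiv.Perm ℝ :=
  lift (fun k => MulAut.conj (Equiv.addRight (k : ℝ)) plMap) fun i j hij => by
    have h : (i : ℝ) + 1 ≤ j := by exact_mod_cast hij
    ext t
    simp only [MulAut.conj_apply, Equiv.Perm.mul_apply, Equiv.Perm.inv_def,
      Equiv.addRight_symm, Equiv.coe_addRight, plMap_apply, Nat.cast_add, Nat.cast_one]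
    split_ifs <;> linarith

theorem act_x_zero : act (x 0) = plMap := by
  refine (lift_x _ _ 0).trans ?_
  ext t
  simp

theorem act_shift (g : ThompsonF) : act (shift g) = MulAut.conj (Equiv.addRight (1 : ℝ)) (act g) := by
  have h : act.comp shift = (MulAut.conj (Equiv.addRight (1 : ℝ))).toMonoidHom.comp act := by
    refine hom_ext fun k => ?_
    simp only [MonoidHom.comp_apply, shift_x, MulEquiv.coe_toMonoidHom]
    refine (lift_x _ _ (k + 1)).trans ?_
    refine Eq.trans ?_ (congrArg _ (lift_x _ _ k).symm)
    ext t
    simp only [MulAut.conj_apply, Equiv.Perm.mul_apply, Equiv.Perm.inv_def,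
      Equiv.addRight_symm, Equiv.coe_addRight, Nat.cast_add, Nat.cast_one]
    ring_nf
  exact DFunLike.congr_fun h g

theorem act_of_nonpos (g : ThompsonF) {t : ℝ} (ht : t ≤ 0) : act g t = t := by
  have hg : g ∈ Subgroup.closure (Set.range x) := by
    have := PresentedGroup.closure_range_of thompsonRels
    exact this ▸ Subgroup.mem_top g
  suffices h : Subgroup.closure (Set.range x) ≤
      (MulAction.stabilizer (Equiv.Perm ℝ) t).comap act from h hg
  rw [Subgroup.closure_le]
  rintro _ ⟨k, rfl⟩
  have hk : act (x k) = _ := lift_x _ _ k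
  have h0 : t + -(k : ℝ) ≤ 0 := by linarith [Nat.cast_nonneg (α := ℝ) k]
  simp [MulAction.mem_stabilizer_iff, hk, plMap_apply, h0]

theorem plMap_pow_injective : Function.Injective fun a : ℕ => (plMap ^ a) (1 / 2 : ℝ) := by
  have hpos : ∀ a : ℕ, 0 < (plMap ^ a) (1 / 2 : ℝ) := by
    intro a
    induction a with
    | zero => norm_num
    | succ a ih =>
      rw [pow_succ', Equiv.Perm.mul_apply, plMap_apply]
      split_ifs <;> linarith
  refine (strictAnti_nat_of_succ_lt fun a => ?_).injective
  have := hpos a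
  rw [pow_succ', Equiv.Perm.mul_apply, plMap_apply]
  split_ifs <;> linarith

/-- Shifted elements fix the point 1/2, whose images under powers of `plMap` are distinct. Hence the
outer exponents agree, and cancelling them leaves an inner element that also acts trivially. -/
theorem IsFrac.eq_one_of_act_eq_one {m k : ℕ} {g : ThompsonF} (h : IsFrac m k g)
    (hg : act g = 1) : g = 1 := by
  induction m generalizing k g with
  | zero => exact h
  | succ m ih =>
    obtain ⟨a, b, l, h, hl, hf, rfl⟩ := h
    rw [map_mul, map_inv, mul_inv_eq_one, map_mul, map_pow, map_pow, act_x_zero] at hg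
    have hfix : act (ThompsonF.shift h) (1 / 2) = 1 / 2 := by
      rw [act_shift]
      have := act_of_nonpos h (t := (1 / 2 : ℝ) + -1) (by norm_num)
      simp only [MulAut.conj_apply, Equiv.Perm.mul_apply, Equiv.Perm.inv_def,
        Equiv.addRight_symm, Equiv.coe_addRight, this]
      norm_num
    have hab : a = b := plMap_pow_injective (by
      have := DFunLike.congr_fun hg (1 / 2 : ℝ)
      rwa [Equiv.Perm.mul_apply, hfix] at this)
    subst hab
    rw [mul_eq_left, act_shift, map_eq_one_iff _ (MulEquiv.injective _)] at hg
    simp [ih hf hg]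

theorem act_injective : Function.Injective act :=
  (injective_iff_map_eq_one act).mpr fun g => (isFrac_wordLength g).eq_one_of_act_eq_one

theorem shift_injective : Function.Injective shift :=
  (injective_iff_map_eq_one shift).mpr fun g hg => by
    have h := act_shift g
    rw [hg, map_one, eq_comm, map_eq_one_iff _ (MulEquiv.injective _)] at h
    exact act_injective (h.trans (map_one _).symm)

/-! ### Peeling off generators from fraction forms -/

/-- In a form `x 0 ^ c * shift h * (x 0 ^ b)⁻¹` of the element, the exponent sum forces `c = a + b`.
Moving `x 0 ^ b` across then identifies `h` with the `b`-fold shift of `g`. -/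
theorem IsFrac.of_x_zero_pow_mul_shift {m k a : ℕ} {g : ThompsonF}
    (h : IsFrac m k (x 0 ^ a * ThompsonF.shift g)) : ∃ k', k' + a ≤ k ∧ IsFrac m k' g := by
  induction m generalizing k a g with
  | zero =>
    have h : x 0 ^ a * ThompsonF.shift g = 1 := h
    have ha : a = 0 := by
      have := congrArg (fun g => (exponent g).toAdd) h
      simpa [-toAdd_eq_zero] using this
    subst ha
    rw [pow_zero, one_mul, map_eq_one_iff _ shift_injective] at h
    exact ⟨0, by omega, h⟩
  | succ m ih =>
    obtain ⟨c, b, l, h, hl, hf, he⟩ := h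
    have hc : c = a + b := by
      have := congrArg exponent he
      simp only [map_mul, map_pow, map_inv, exponent_x_zero, exponent_shift, mul_one] at this
      have := congrArg Multiplicative.toAdd this
      simp at this
      omega
    subst hc
    have hh : h = ThompsonF.shift^[b] g := by
      apply shift_injective
      have h1 := shift_mul_x_zero_pow g b
      rw [eq_mul_inv_iff_mul_eq, mul_assoc, h1, ← mul_assoc, ← pow_add] at he
      exact (mul_left_cancel he).symm
    -- The shifts are undone one at a time by the induction hypothesis with exponent 0, since the
    -- form of `h` has one level less.
    have hunshift : ∀ b : ℕ, IsFrac m l (ThompsonF.shift^[b] g) → IsFrac m l g := by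
      intro b hb
      induction b with
      | zero => exact hb
      | succ b ihb =>
        rw [Function.iterate_succ_apply'] at hb
        obtain ⟨l', hl', hf'⟩ := ih (a := 0) (by simpa using hb)
        exact ihb (hf'.mono le_rfl (by omega))
    exact ⟨l, by omega, (hunshift b (hh ▸ hf)).mono (by omega) le_rfl⟩

/-- Conjugation by `(x 1)⁻¹` raises the index by one, and conjugation by `x 0` lowers it again. -/
theorem y_zero_mul_x (k : ℕ) : y 0 * x (k + 2) = x (k + 2) * y 0 := by
  have h1 : (x 1)⁻¹ * x (k + 2) = x (k + 3) * (x 1)⁻¹ := by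
    rw [← conj_x (show 1 < k + 2 by omega)]; group
  have h0 : x 0 * x (k + 3) = x (k + 2) * x 0 := (x_mul_x (show 0 < k + 2 by omega)).symm
  simp only [y, mul_zero, zero_add]
  rw [mul_assoc, h1, ← mul_assoc, h0, mul_assoc]

theorem commute_y_zero (g : ThompsonF) : Commute (y 0) (shift (shift g)) := by
  have h : (MulAut.conj (y 0)).toMonoidHom.comp (shift.comp shift) = shift.comp shift := by
    refine hom_ext fun k => ?_
    simp only [MonoidHom.comp_apply, shift_x, MulEquiv.coe_toMonoidHom, MulAut.conj_apply]
    rw [y_zero_mul_x, mul_inv_cancel_right]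
  have h1 := DFunLike.congr_fun h g
  simp only [MonoidHom.comp_apply, MulEquiv.coe_toMonoidHom, MulAut.conj_apply] at h1
  exact mul_inv_eq_iff_eq_mul.mp h1

theorem IsFrac.of_y_zero_pow_mul {m k : ℕ} (v : ℕ) {g : ThompsonF}
    (h : IsFrac m k (y 0 ^ v * ThompsonF.shift (ThompsonF.shift g))) :
    ∃ k', k' + v ≤ k ∧ IsFrac m k' g := by
  -- Chosen so that `y 0 ^ v * shift (shift g) = x 0 ^ v * shift (u v)`: each factor `x 0 * (x
  -- 1)⁻¹`, commuted to the right end, contributes `x 0` in front and `(x 0)⁻¹` inside the shift.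
  let u : ℕ → ThompsonF := fun v =>
    Nat.rec (ThompsonF.shift g) (fun _ w => ThompsonF.shift w * (x 0)⁻¹) v
  have hu : ∀ v, u (v + 1) = ThompsonF.shift (u v) * (x 0)⁻¹ := fun _ => rfl
  have hy : ∀ v, y 0 ^ v * ThompsonF.shift (ThompsonF.shift g) =
      x 0 ^ v * ThompsonF.shift (u v) := by
    intro v
    induction v with
    | zero => simp [u]
    | succ v ih =>
      have hcomm := ((commute_y_zero g).pow_left v).eq
      rw [pow_succ, mul_assoc, (commute_y_zero g).eq, ← mul_assoc, ih, hu, map_mul, map_inv,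
        shift_x, y, pow_succ, mul_assoc, mul_assoc (x 0 ^ v), ← mul_assoc, mul_assoc (x 0 ^ v),
        ← mul_assoc (ThompsonF.shift (u v)), mul_zero, shift_mul_x_zero]
      simp only [mul_assoc, zero_add]
  have hpeel : ∀ v k, IsFrac m k (u v) → IsFrac m k g := by
    intro v
    induction v with
    | zero =>
      intro k hk
      obtain ⟨k', hk', hf⟩ := IsFrac.of_x_zero_pow_mul_shift (a := 0) (by simpa [u] using hk)
      exact hf.mono le_rfl (by omega)
    | succ v ih =>
      intro k hk
      -- The inverse of `u (v + 1)` is `x 0 * shift (u v)⁻¹`, which again has the shape that can be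
      -- peeled.
      have hk := hk.inv
      rw [hu, mul_inv_rev, inv_inv, ← map_inv] at hk
      obtain ⟨k', hk', hf⟩ := IsFrac.of_x_zero_pow_mul_shift (a := 1) ((pow_one (x 0)).symm ▸ hk)
      exact ih k ((inv_inv (u v) ▸ hf.inv).mono le_rfl (by omega))
  rw [hy] at h
  obtain ⟨k', hk', hf⟩ := h.of_x_zero_pow_mul_shift
  exact ⟨k', hk', hpeel v k' hf⟩

theorem IsFrac.of_y_zero_zpow_mul {m k : ℕ} (v : ℤ) {g : ThompsonF}
    (h : IsFrac m k (y 0 ^ v * ThompsonF.shift (ThompsonF.shift g))) :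
    ∃ k', k' + v.natAbs ≤ k ∧ IsFrac m k' g := by
  rcases Int.natAbs_eq v with hv | hv
  · rw [hv, zpow_natCast] at h
    exact h.of_y_zero_pow_mul
  · have h := h.inv
    rw [mul_inv_rev, ← map_inv, ← map_inv, ← zpow_neg, hv, neg_neg, zpow_natCast,
      ← ((commute_y_zero g⁻¹).pow_left _).eq] at h
    obtain ⟨k', hk', hf⟩ := h.of_y_zero_pow_mul
    exact ⟨k', hk', inv_inv g ▸ hf.inv⟩

/-! ### The embedding of `F × ℤⁿ` -/

/-- The product of `y 0 ^ v 0, …, y (n - 1) ^ v (n - 1)` and the `2n`-fold shift of `g`. -/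
def embed : (n : ℕ) → ThompsonF → (Fin n → ℤ) → ThompsonF
  | 0, g, _ => g
  | n + 1, g, v => y 0 ^ v 0 * shift (shift (embed n g (Fin.tail v)))

theorem shift_shift_y (i : ℕ) : shift (shift (y i)) = y (i + 1) := by
  simp [y, mul_add, add_right_comm]

theorem embed_one_zero (n : ℕ) : embed n 1 0 = 1 := by
  induction n with
  | zero => rfl
  | succ n ih =>
    have htail : Fin.tail (0 : Fin (n + 1) → ℤ) = 0 := rfl
    simp [embed, htail, ih]

theorem embed_mul (n : ℕ) (g h : ThompsonF) (v w : Fin n → ℤ) :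
    embed n (g * h) (v + w) = embed n g v * embed n h w := by
  induction n with
  | zero => rfl
  | succ n ih =>
    have htail : Fin.tail (v + w) = Fin.tail v + Fin.tail w := rfl
    have hcomm := ((commute_y_zero (embed n g (Fin.tail v))).zpow_left (w 0)).eq
    simp only [embed, htail, ih, map_mul, Pi.add_apply, zpow_add]
    rw [mul_assoc, mul_assoc, ← mul_assoc (y 0 ^ w 0), hcomm]
    simp only [mul_assoc]

theorem embed_x_zero (n k : ℕ) : embed n (x k) 0 = x (2 * n + k) := by
  induction n with
  | zero => simp [embed]
  | succ n ih =>
    have htail : Fin.tail (0 : Fin (n + 1) → ℤ) = 0 := rfl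
    simp only [embed, Pi.zero_apply, zpow_zero, one_mul, htail, ih, shift_x]
    congr 1; ring

theorem embed_one (n : ℕ) (v : Fin n → ℤ) :
    embed n 1 v = (List.ofFn fun i : Fin n => y i ^ v i).prod := by
  induction n with
  | zero => simp [embed]
  | succ n ih =>
    simp only [embed, ih, map_list_prod, List.ofFn_succ, List.prod_cons, List.map_ofFn]
    congr 3
    funext i
    simp [map_zpow, shift_shift_y, Fin.tail]

theorem embed_one_single (n : ℕ) (i : Fin n) : embed n 1 (Pi.single i 1) = y i := by
  induction n with
  | zero => exact i.elim0
  | succ n ih =>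
    refine Fin.cases ?_ (fun i => ?_) i
    · have htail : Fin.tail (Pi.single 0 1 : Fin (n + 1) → ℤ) = 0 := by
        ext j; simp [Fin.tail]
      simp [embed, htail, embed_one_zero]
    · have htail : Fin.tail (Pi.single i.succ 1 : Fin (n + 1) → ℤ) = Pi.single i 1 := by
        ext j; simp [Fin.tail, Pi.single_apply]
      simp [embed, htail, ih, shift_shift_y]

theorem IsFrac.of_embed {n m k : ℕ} {g : ThompsonF} {v : Fin n → ℤ}
    (h : IsFrac m k (embed n g v)) : ∃ k', k' + ∑ i, (v i).natAbs ≤ k ∧ IsFrac m k' g := by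
  induction n generalizing k with
  | zero => exact ⟨k, by simp, h⟩
  | succ n ih =>
    obtain ⟨k₁, hk₁, hf₁⟩ := IsFrac.of_y_zero_zpow_mul (v 0) h
    obtain ⟨k₂, hk₂, hf₂⟩ := ih hf₁
    refine ⟨k₂, ?_, hf₂⟩
    rw [Fin.sum_univ_succ]
    simp only [Fin.tail] at hk₂
    omega

/-- If the image has length `N`, its form has `2N` levels and budget `N`. Peeling keeps the levels,
so the left side is at most `N + 2 * 2N`. -/
theorem wordLength_add_sum_le (n : ℕ) (g : ThompsonF) (v : Fin n → ℤ) :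
    wordLength gens g + ∑ i, (v i).natAbs ≤ 5 * wordLength gens (embed n g v) := by
  obtain ⟨k, hk, hf⟩ := (isFrac_wordLength (embed n g v)).of_embed
  have := hf.wordLength_le
  omega

/-- The embedding of `F × ℤⁿ` as a homomorphism. -/
def embedHom (n : ℕ) : ThompsonF × Multiplicative (Fin n → ℤ) →* ThompsonF where
  toFun p := embed n p.1 p.2.toAdd
  map_one' := embed_one_zero n
  map_mul' p q := embed_mul n p.1 q.1 p.2.toAdd q.2.toAdd

theorem embedHom_injective (n : ℕ) : Function.Injective (embedHom n) := by
  refine (injective_iff_map_eq_one _).mpr fun ⟨g, v⟩ h => ?_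
  -- The identity has a form with no levels and budget 0; peeling leaves such a form for `g` and no
  -- room for a nonzero exponent.
  have hF : IsFrac 0 0 (embed n g v.toAdd) := h
  obtain ⟨k, hk, hg⟩ := hF.of_embed
  refine Prod.ext hg (Multiplicative.toAdd.injective (funext fun i => ?_))
  have := Finset.single_le_sum (f := fun i => (v.toAdd i).natAbs)
    (fun _ _ => Nat.zero_le _) (Finset.mem_univ i)
  exact Int.natAbs_eq_zero.mp (Nat.le_zero.mp (this.trans (by omega)))

theorem embed_one_mem_subgroupA (n : ℕ) (v : Fin n → ℤ) : embed n 1 v ∈ subgroupA n := by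
  rw [embed_one]
  refine Subgroup.list_prod_mem _ fun g hg => ?_
  obtain ⟨i, rfl⟩ := List.mem_ofFn.mp hg
  have hi : (i : ℕ) ∈ {j | j < n} := i.2
  exact Subgroup.zpow_mem _ (Subgroup.subset_closure (Set.mem_image_of_mem y hi)) _

theorem range_embedHom_comp_inr (n : ℕ) :
    ((embedHom n).comp (MonoidHom.inr _ _)).range = subgroupA n := by
  refine le_antisymm ?_ ((Subgroup.closure_le _).mpr ?_)
  · rintro _ ⟨v, rfl⟩
    exact embed_one_mem_subgroupA n v.toAdd
  · rintro _ ⟨i, hi, rfl⟩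
    exact ⟨Multiplicative.ofAdd (Pi.single ⟨i, hi⟩ 1), embed_one_single n ⟨i, hi⟩⟩

theorem range_embedHom (n : ℕ) : (embedHom n).range = subgroupH n := by
  refine le_antisymm ?_ ((Subgroup.closure_le _).mpr (Set.union_subset ?_ ?_))
  · rintro _ ⟨⟨g, v⟩, rfl⟩
    have hv : embedHom n (1, v) ∈ subgroupH n :=
      Subgroup.closure_mono Set.subset_union_left (embed_one_mem_subgroupA n v.toAdd)
    have hg : (⊤ : Subgroup ThompsonF) ≤
        (subgroupH n).comap ((embedHom n).comp (MonoidHom.inl _ _)) := by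
      rw [← closure_gens, Subgroup.closure_le]
      rintro _ (rfl | rfl)
      · exact Subgroup.subset_closure (Or.inr (Or.inl (embed_x_zero n 0)))
      · exact Subgroup.subset_closure (Or.inr (Or.inr (embed_x_zero n 1)))
    have hmul := mul_mem (Subgroup.mem_comap.mp (hg (Subgroup.mem_top g))) hv
    rwa [MonoidHom.comp_apply, ← map_mul, MonoidHom.inl_apply, Prod.mk_mul_mk, mul_one,
      one_mul] at hmul
  · rintro _ ⟨i, hi, rfl⟩
    exact ⟨(1, Multiplicative.ofAdd (Pi.single ⟨i, hi⟩ 1)), embed_one_single n ⟨i, hi⟩⟩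
  · rintro _ (rfl | rfl)
    exacts [⟨(x 0, 1), embed_x_zero n 0⟩, ⟨(x 1, 1), embed_x_zero n 1⟩]

/-! ### Finite generation and the quasi-isometric embeddings -/

theorem finite_gens : gens.Finite := Set.toFinite {x 0, x 1}

theorem finite_image_y (n : ℕ) : (y '' {i | i < n}).Finite := (Set.finite_lt_nat n).image y

theorem subgroupA_fg (n : ℕ) : (subgroupA n).FG :=
  (Subgroup.fg_iff _).mpr ⟨_, rfl, finite_image_y n⟩

theorem subgroupH_fg (n : ℕ) : (subgroupH n).FG :=
  (Subgroup.fg_iff _).mpr ⟨_, rfl, (finite_image_y n).union (Set.toFinite _)⟩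

/-- A homomorphism from `ℤⁿ` is Lipschitz for the `ℓ¹`-norm and a word length. -/
theorem exists_wordLength_map_le_sum {G : Type*} [Group G] {T : Set G}
    (hT : Subgroup.closure T = ⊤) {n : ℕ} (f : Multiplicative (Fin n → ℤ) →* G) :
    ∃ c : ℕ, ∀ v : Fin n → ℤ,
      wordLength T (f (Multiplicative.ofAdd v)) ≤ c * ∑ i, (v i).natAbs := by
  let z : Fin n → G := fun i => f (Multiplicative.ofAdd (Pi.single i 1))
  refine ⟨∑ i, wordLength T (z i), fun v => ?_⟩
  have hv : f (Multiplicative.ofAdd v) = (List.ofFn fun i => z i ^ v i).prod := by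
    have : Multiplicative.ofAdd v = (List.ofFn fun i : Fin n =>
        (Multiplicative.ofAdd (Pi.single i 1 : Fin n → ℤ)) ^ v i).prod := by
      rw [List.prod_ofFn]
      simp only [← ofAdd_zsmul, ← ofAdd_sum]
      congr 1
      ext j
      simp [Finset.sum_apply, Pi.single_apply]
    rw [this, map_list_prod, List.map_ofFn]
    congr 2
    funext i
    exact map_zpow f _ _
  rw [hv]
  refine (wordLength_list_prod_le hT _).trans ?_
  rw [List.map_ofFn, List.sum_ofFn, Finset.mul_sum]
  refine Finset.sum_le_sum fun i hi => (wordLength_zpow_le hT _ _).trans ?_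
  rw [mul_comm]
  exact Nat.mul_le_mul_right _
    (Finset.single_le_sum (f := fun i => wordLength T (z i)) (fun _ _ => Nat.zero_le _) hi)

theorem isQIEmbeddedSubgroup_subgroupH (n : ℕ) : IsQIEmbeddedSubgroup gens (subgroupH n) := by
  refine isQIEmbeddedSubgroup_of_wordLength_le finite_gens closure_gens (subgroupH_fg n)
    fun T hT => ?_
  let f : ThompsonF × Multiplicative (Fin n → ℤ) →* subgroupH n :=
    (embedHom n).codRestrict _ fun p => range_embedHom n ▸ ⟨p, rfl⟩
  obtain ⟨c, hc⟩ := exists_wordLength_map_le (f.comp (MonoidHom.inl _ _)) finite_gens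
    closure_gens hT
  obtain ⟨d, hd⟩ := exists_wordLength_map_le_sum hT (f.comp (MonoidHom.inr _ _))
  refine ⟨(c + d) * 5, fun ⟨a, ha⟩ => ?_⟩
  obtain ⟨⟨g, v⟩, rfl⟩ : a ∈ (embedHom n).range := range_embedHom n ▸ ha
  have hsplit : (⟨embedHom n (g, v), ha⟩ : subgroupH n) =
      f.comp (MonoidHom.inl _ _) g * f.comp (MonoidHom.inr _ _) v := by
    simp only [MonoidHom.comp_apply, MonoidHom.inl_apply, MonoidHom.inr_apply, ← map_mul,
      Prod.mk_mul_mk, mul_one, one_mul]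
    rfl
  have h1 := wordLength_mul_le hT (f.comp (MonoidHom.inl _ _) g) (f.comp (MonoidHom.inr _ _) v)
  have h2 := hc g
  have h3 := hd v.toAdd
  rw [ofAdd_toAdd] at h3
  have h4 := wordLength_add_sum_le n g v.toAdd
  rw [mul_assoc]
  refine le_trans ?_ (Nat.mul_le_mul_left (c + d) h4)
  rw [hsplit, mul_add, add_mul, add_mul]
  omega

theorem isQIEmbeddedSubgroup_subgroupA (n : ℕ) : IsQIEmbeddedSubgroup gens (subgroupA n) := by
  refine isQIEmbeddedSubgroup_of_wordLength_le finite_gens closure_gens (subgroupA_fg n)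
    fun T hT => ?_
  let f : Multiplicative (Fin n → ℤ) →* subgroupA n :=
    ((embedHom n).comp (MonoidHom.inr _ _)).codRestrict _
      fun v => range_embedHom_comp_inr n ▸ ⟨v, rfl⟩
  obtain ⟨d, hd⟩ := exists_wordLength_map_le_sum hT f
  refine ⟨d * 5, fun ⟨a, ha⟩ => ?_⟩
  obtain ⟨v, rfl⟩ : a ∈ ((embedHom n).comp (MonoidHom.inr _ _)).range :=
    range_embedHom_comp_inr n ▸ ha
  have h4 := wordLength_add_sum_le n 1 v.toAdd
  rw [mul_assoc]
  exact (hd v.toAdd).trans (Nat.mul_le_mul_left d ((Nat.le_add_left _ _).trans h4))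

end ThompsonF

theorem corollary4 (n : ℕ) :
    (∃ e : ThompsonF × Multiplicative (Fin n → ℤ) ≃* ThompsonF.subgroupH n,
      ((e (ThompsonF.x 0, 1) : ThompsonF) = ThompsonF.x (2 * n)) ∧
      ((e (ThompsonF.x 1, 1) : ThompsonF) = ThompsonF.x (2 * n + 1)) ∧
      (∀ i : Fin n, (e (1, Multiplicative.ofAdd (Pi.single i 1)) : ThompsonF) =
        ThompsonF.y i) ∧
      (∀ g : ThompsonF, g ∈ ThompsonF.subgroupA n ↔
        ∃ v : Multiplicative (Fin n → ℤ), (e (1, v) : ThompsonF) = g)) ∧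
    IsQIEmbeddedSubgroup ThompsonF.gens (ThompsonF.subgroupH n) ∧
    IsQIEmbeddedSubgroup ThompsonF.gens (ThompsonF.subgroupA n) := by
  refine ⟨?_, ThompsonF.isQIEmbeddedSubgroup_subgroupH n,
    ThompsonF.isQIEmbeddedSubgroup_subgroupA n⟩
  let e : ThompsonF × Multiplicative (Fin n → ℤ) ≃* ThompsonF.subgroupH n :=
    (MonoidHom.ofInjective (ThompsonF.embedHom_injective n)).trans
      (MulEquiv.subgroupCongr (ThompsonF.range_embedHom n))
  refine ⟨e, ThompsonF.embed_x_zero n 0, ThompsonF.embed_x_zero n 1,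
    ThompsonF.embed_one_single n, fun g => ?_⟩
  rw [← ThompsonF.range_embedHom_comp_inr, MonoidHom.mem_range]
  rfl
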